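/- Let $G$ be a finite solvable group and let $\chi$ be an irreducible complex character of $G$. Let $\eta(\chi)$ denote the number of distinct non-principal irreducible constituents of the character $\chi\overline{\chi}$, i.e. the number of irreducible complex characters $\alpha\neq 1_G$ of $G$ with $[\chi\overline{\chi},\alpha]\neq 0$, where $[\Theta,\Phi]=\frac1{|G|}\sum_{g\in G}\Theta(g)\overline{\Phi(g)}$. Then the degree $\chi(1)$ has at most $\eta(\chi)$ distinct prime divisors. If, in addition, $G$ is supersolvable (that is, $G$ has a finite series $1=N_0\le N_1\le\dots\le N_n=G$ of normal subgroups of $G$ with every factor $N_{i+1}/N_i$ cyclic) and $\chi(1)>1$, then $\chi(1)$ is a product of at most $\eta(\chi)-1$ primes, counted with multiplicity. -/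

import Mathlib

open scoped ComplexConjugate

noncomputable section

/-- The set `Irr(G)` of irreducible complex characters of `G`, as functions `G → ℂ`: the characters
of the irreducible representations of `G` on finite-dimensional complex vector spaces. Up to
isomorphism every such space is some `ℂⁿ`. -/
def Irr (G : Type*) [Group G] : Set (G → ℂ) :=
  {χ | ∃ (n : ℕ) (ρ : Representation ℂ G (Fin n → ℂ)), ρ.IsIrreducible ∧ ρ.character = χ}

/-- The inner product `[Θ, Φ] = |G|⁻¹ ∑ g, Θ(g) * conj (Φ(g))` of complex functions on a
finite group. -/
def charInner {G : Type*} [Group G] [Fintype G] (Θ Φ : G → ℂ) : ℂ :=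
  (Fintype.card G : ℂ)⁻¹ * ∑ g : G, Θ g * conj (Φ g)

/-- The set of non-principal irreducible constituents of `χ * conj χ`: the irreducible characters
`α` other than the constant function `1` with `[χ * conj χ, α] ≠ 0`. -/
def nonprincipalConstituents {G : Type*} [Group G] [Fintype G] (χ : G → ℂ) : Set (G → ℂ) :=
  {α | α ∈ Irr G ∧ α ≠ 1 ∧ charInner (fun g => χ g * conj (χ g)) α ≠ 0}

/-- `η(χ)`: the number of distinct non-principal irreducible constituents of `χ * conj χ`. -/
def eta {G : Type*} [Group G] [Fintype G] (χ : G → ℂ) : ℕ :=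
  (nonprincipalConstituents χ).ncard

/-- A group `G` is supersolvable if it has a finite series `1 = N₀ ≤ N₁ ≤ ⋯ ≤ Nₙ = G` of normal
subgroups of `G` all of whose factors `Nᵢ₊₁ / Nᵢ` are cyclic. (The values `N i` for `i > n`
play no role.) -/
def IsSupersolvable (G : Type*) [Group G] : Prop :=
  ∃ (n : ℕ) (N : ℕ → Subgroup G) (_ : ∀ i, (N i).Normal),
    N 0 = ⊥ ∧ N n = ⊤ ∧
      ∀ i < n, N i ≤ N (i + 1) ∧ IsCyclic (N (i + 1) ⧸ (N i).subgroupOf (N (i + 1)))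

end

/-!
Let `V` afford `χ`, irreducible over `G`. For a normal subgroup `N` all irreducible
`N`-subrepresentations of `V` have the same dimension `d(N)` (Clifford,
`finrank_eq_of_simpleUnder_normal`), with `d(1) = 1` and `d(G) = χ(1)`. Let `A(N)` be the set of
non-principal constituents of `χ * conj χ` that are trivial on `N` (`constituentsOver`); it shrinks
as `N` grows. Both statements come from comparing `d` and `A` along a chain of normal subgroups of
`G`, descending from `G` to `1`.

* If `N ≤ M` are normal and `d(N) ≠ d(M)`, then `A(M)` is strictly smaller than `A(N)`
  (`finrank_eq_or_constituentsOver_ssubset`). Projections onto `N`-irreducible subspaces show that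
  some endomorphism of `V` commutes with `N` but not with `M`, so in the `G`-representation `End V`,
  with character `χ * conj χ`, there are `N`-fixed vectors which are not `M`-fixed; an irreducible
  subrepresentation of the space of `N`-fixed vectors meeting the `M`-fixed ones trivially supplies
  the constituent (`constituentsOver_ssubset`).
* If `M / N` is a `p`-group then `d(M) / d(N)` is a power of `p`, and it is `1` or `p` if
  `M / N` has order `p` (`finrank_of_simpleUnder_index_prime` and its corollaries).

In a solvable group a chain with factors of prime power order exists, and each prime divisor of
`χ(1)` must enter at a step where `A` strictly shrinks; so there are at most `|A(1)| ≤ η(χ)` of them.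
In a supersolvable group the steps can be taken of prime order, so that each strict step accounts
for only one prime factor. Moreover, if `d` first grows from `1` between `N` and `M`, then `N`
does not act by scalars (otherwise `M` would stabilize a line), so `A(N)` is strictly smaller than
`A(1)`, which gives the additional constituent.
-/

/-! ### Stable and irreducible subspaces for a subgroup -/

namespace Representation

variable {G V : Type*} [Group G] [AddCommGroup V] [Module ℂ V]

/-- The subspace `S` is stable under the elements of the subgroup `H`. Subgroups of `G` are made to
act on subspaces of one fixed representation space, so that iterated restrictions stay in `V`. -/
def StableUnder (ρ : Representation ℂ G V) (H : Subgroup G) (S : Submodule ℂ V) : Prop :=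
  ∀ h ∈ H, ∀ v ∈ S, ρ h v ∈ S

/-- The subspace `S` is an irreducible `H`-subrepresentation of `V`. -/
structure SimpleUnder (ρ : Representation ℂ G V) (H : Subgroup G) (S : Submodule ℂ V) : Prop where
  ne_bot : S ≠ ⊥
  stable : ρ.StableUnder H S
  eq_of_le : ∀ T ≤ S, T ≠ ⊥ → ρ.StableUnder H T → T = S

/-- The linear map `T` commutes with the action of the subgroup `H`. -/
def CommutesWith (ρ : Representation ℂ G V) (H : Subgroup G) (T : Module.End ℂ V) : Prop :=
  ∀ h ∈ H, ∀ v, T (ρ h v) = ρ h (T v)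

variable {ρ : Representation ℂ G V}

lemma StableUnder.mono {H K : Subgroup G} (hKH : K ≤ H) {S : Submodule ℂ V}
    (hS : ρ.StableUnder H S) : ρ.StableUnder K S :=
  fun h hh => hS h (hKH hh)

lemma CommutesWith.mono {H K : Subgroup G} (hKH : K ≤ H) {T : Module.End ℂ V}
    (hT : ρ.CommutesWith H T) : ρ.CommutesWith K T :=
  fun h hh => hT h (hKH hh)

lemma apply_inv_apply (g : G) (v : V) : ρ g (ρ g⁻¹ v) = v := by
  rw [← Module.End.mul_apply, ← map_mul]; simp

lemma apply_mul_apply (g h : G) (v : V) : ρ (g * h) v = ρ g (ρ h v) := by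
  rw [map_mul, Module.End.mul_apply]

/-- A stable subspace as a subrepresentation of the restriction to `H`. -/
def StableUnder.subrep {H : Subgroup G} {S : Submodule ℂ V} (hS : ρ.StableUnder H S) :
    Subrepresentation (ρ.comp H.subtype : Representation ℂ H V) :=
  ⟨S, fun h v hv => hS h h.2 v hv⟩

lemma stableUnder_toSubmodule {H : Subgroup G}
    (σ : Subrepresentation (ρ.comp H.subtype : Representation ℂ H V)) :
    ρ.StableUnder H σ.toSubmodule :=
  fun h hh _ hv => σ.apply_mem_toSubmodule ⟨h, hh⟩ hv

/-- Maschke's theorem: an equivariant projection onto a stable subspace. -/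
lemma StableUnder.exists_projection [Finite G] {H : Subgroup G} {S : Submodule ℂ V}
    (hS : ρ.StableUnder H S) :
    ∃ e : Module.End ℂ V, ρ.CommutesWith H e ∧ (∀ v, e v ∈ S) ∧ ∀ v ∈ S, e v = v := by
  obtain ⟨C, hC⟩ := exists_isCompl hS.subrep
  have hC' : IsCompl S C.toSubmodule := by
    refine ⟨?_, ?_⟩
    · rw [disjoint_iff]
      exact congrArg Subrepresentation.toSubmodule hC.inf_eq_bot
    · rw [codisjoint_iff]
      exact congrArg Subrepresentation.toSubmodule hC.sup_eq_top
  have hstC := stableUnder_toSubmodule C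
  refine ⟨S.projection _ hC', fun h hh v => ?_, Submodule.projection_apply_mem hC',
    fun v hv => Submodule.projection_apply_left hC' ⟨v, hv⟩⟩
  have hv : v ∈ S ⊔ C.toSubmodule := by rw [hC'.sup_eq_top]; exact Submodule.mem_top
  obtain ⟨s, hs, c, hc, rfl⟩ := Submodule.mem_sup.1 hv
  have h1 : ∀ s ∈ S, S.projection _ hC' s = s := fun s hs =>
    Submodule.projection_apply_left hC' ⟨s, hs⟩
  have h2 : ∀ c ∈ C.toSubmodule, S.projection _ hC' c = 0 := fun c hc =>
    (Submodule.projection_apply_eq_zero_iff hC').2 hc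
  rw [map_add, map_add, map_add, h1 _ (hS h hh s hs), h2 _ (hstC h hh c hc), h1 s hs, h2 c hc]
  simp

variable [FiniteDimensional ℂ V]

lemma StableUnder.exists_simpleUnder_le {H : Subgroup G} {S : Submodule ℂ V}
    (hS : ρ.StableUnder H S) (hne : S ≠ ⊥) : ∃ T ≤ S, ρ.SimpleUnder H T := by
  obtain ⟨T, ⟨hTS, hT0, hT⟩, hmin⟩ := WellFounded.has_min
    (wellFounded_lt (α := Submodule ℂ V)) {T | T ≤ S ∧ T ≠ ⊥ ∧ ρ.StableUnder H T}
    ⟨S, le_rfl, hne, hS⟩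
  refine ⟨T, hTS, hT0, hT, fun U hU hU0 hUs => ?_⟩
  by_contra hne'
  exact hmin U ⟨hU.trans hTS, hU0, hUs⟩ (lt_of_le_of_ne hU hne')

lemma exists_simpleUnder [Nontrivial V] (ρ : Representation ℂ G V) (H : Subgroup G) :
    ∃ T, ρ.SimpleUnder H T := by
  obtain ⟨T, -, hT⟩ := StableUnder.exists_simpleUnder_le (ρ := ρ) (H := H) (S := ⊤)
    (fun _ _ _ _ => Submodule.mem_top) top_ne_bot
  exact ⟨T, hT⟩

lemma simpleUnder_of_finrank_eq_one {H : Subgroup G} {S : Submodule ℂ V}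
    (hS : ρ.StableUnder H S) (h1 : Module.finrank ℂ S = 1) : ρ.SimpleUnder H S := by
  refine ⟨?_, hS, fun T hT hT0 _ => ?_⟩
  · rintro rfl
    simp at h1
  · refine Submodule.eq_of_le_of_finrank_le hT ?_
    rw [h1]
    exact Submodule.one_le_finrank_iff.2 hT0

/-- The image of an `N`-simple subspace under a translate lands in `T` after an `N`-equivariant
projection, and is all of `T` for a suitable translate: otherwise the projection would kill the
`G`-span of `S`, which is the whole space. -/
lemma finrank_le_of_simpleUnder_normal [Finite G] (hρ : ρ.SimpleUnder ⊤ ⊤) {N : Subgroup G}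
    [hN : N.Normal] {S T : Submodule ℂ V} (hS : ρ.SimpleUnder N S) (hT : ρ.SimpleUnder N T) :
    Module.finrank ℂ T ≤ Module.finrank ℂ S := by
  obtain ⟨e, hec, heT, heid⟩ := hT.stable.exists_projection
  obtain ⟨g, s, hs, hgs⟩ : ∃ g : G, ∃ s ∈ S, e (ρ g s) ≠ 0 := by
    by_contra! hcon
    let X : Submodule ℂ V :=
      { carrier := {v | ∀ g, e (ρ g v) = 0}
        add_mem' := fun ha hb g => by rw [map_add, map_add, ha g, hb g, add_zero]
        zero_mem' := fun g => by simp
        smul_mem' := fun c v hv g => by rw [map_smul, map_smul, hv g, smul_zero] }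
    have hX : X = ⊤ := by
      refine hρ.eq_of_le X le_top ?_ fun h _ v hv g => ?_
      · intro h
        refine hS.ne_bot (le_bot_iff.1 ?_)
        rw [← h]
        exact fun s hs g => hcon g s hs
      · rw [← apply_mul_apply]
        exact hv _
    refine hT.ne_bot ((Submodule.eq_bot_iff _).2 fun t ht => ?_)
    have : t ∈ X := by rw [hX]; exact Submodule.mem_top
    have := this 1
    rwa [map_one, Module.End.one_apply, heid t ht] at this
  have hmap : S.map (e ∘ₗ ρ g) = T := by
    refine hT.eq_of_le _ ?_ ?_ ?_
    · rintro _ ⟨v, -, rfl⟩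
      exact heT _
    · exact (Submodule.ne_bot_iff _).2 ⟨_, ⟨s, hs, rfl⟩, hgs⟩
    · rintro n hn _ ⟨v, hv, rfl⟩
      refine ⟨ρ (g⁻¹ * n * g) v, hS.stable _ ?_ v hv, ?_⟩
      · simpa using hN.conj_mem n hn g⁻¹
      · simp only [LinearMap.comp_apply]
        rw [← hec n hn, ← apply_mul_apply, ← apply_mul_apply]
        congr 3
        group
  rw [← hmap]
  exact Submodule.finrank_map_le _ _

/-- The dimension part of Clifford's theorem. -/
lemma finrank_eq_of_simpleUnder_normal [Finite G] (hρ : ρ.SimpleUnder ⊤ ⊤) {N : Subgroup G}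
    [N.Normal] {S T : Submodule ℂ V} (hS : ρ.SimpleUnder N S) (hT : ρ.SimpleUnder N T) :
    Module.finrank ℂ S = Module.finrank ℂ T :=
  le_antisymm (finrank_le_of_simpleUnder_normal hρ hT hS)
    (finrank_le_of_simpleUnder_normal hρ hS hT)

omit [FiniteDimensional ℂ V] in
/-- If every endomorphism commuting with `N` commutes with `M`, then `N`-simple subspaces are
`M`-stable, being ranges of `N`-equivariant projections. -/
lemma SimpleUnder.of_commutesWith [Finite G] {N M : Subgroup G} (hNM : N ≤ M)
    (hcomm : ∀ T, ρ.CommutesWith N T → ρ.CommutesWith M T) {S : Submodule ℂ V}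
    (hS : ρ.SimpleUnder N S) : ρ.SimpleUnder M S := by
  obtain ⟨e, hec, heS, heid⟩ := hS.stable.exists_projection
  refine ⟨hS.ne_bot, fun m hm v hv => ?_, fun T hT hT0 hTs => hS.eq_of_le T hT hT0 (hTs.mono hNM)⟩
  rw [← heid v hv, ← hcomm e hec m hm]
  exact heS _

end Representation

/-! ### Normal subgroups of prime index -/

lemma Subgroup.exists_eq_pow_mul_of_index_prime {G : Type*} [Group G] {K : Subgroup G}
    [K.Normal] {p : ℕ} (hp : p.Prime) (hK : K.index = p) {h : G} (hh : h ∉ K) (g : G) :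
    ∃ j : Fin p, ∃ k ∈ K, g = h ^ (j : ℕ) * k := by
  have : Fact p.Prime := ⟨hp⟩
  have hc : Nat.card (G ⧸ K) = p := hK
  have hne : (QuotientGroup.mk h : G ⧸ K) ≠ 1 := by
    rwa [Ne, QuotientGroup.eq_one_iff]
  obtain ⟨m, hm⟩ := mem_powers_of_prime_card (g' := (QuotientGroup.mk g : G ⧸ K)) hc hne
  refine ⟨⟨m % p, Nat.mod_lt _ hp.pos⟩, (h ^ (m % p))⁻¹ * g, ?_, by group⟩
  rw [← QuotientGroup.eq_one_iff, QuotientGroup.mk_mul, QuotientGroup.mk_inv, QuotientGroup.mk_pow,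
    inv_mul_eq_one, ← hm]
  exact hc ▸ pow_mod_natCard _ m

lemma Subgroup.pow_index_mem_of_normal {G : Type*} [Group G] {K : Subgroup G} [K.Normal] (h : G) :
    h ^ K.index ∈ K := by
  rw [← QuotientGroup.eq_one_iff, QuotientGroup.mk_pow]
  exact pow_card_eq_one'

namespace Representation

variable {G V : Type*} [Group G] [AddCommGroup V] [Module ℂ V] {ρ : Representation ℂ G V}

/-- The endomorphisms of `V` commuting with a normal subgroup form a subrepresentation of
`End V`. -/
def commutant (ρ : Representation ℂ G V) (N : Subgroup G) [hN : N.Normal] :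
    Subrepresentation (linHom ρ ρ) where
  toSubmodule :=
    { carrier := {T | ρ.CommutesWith N T}
      add_mem' := fun ha hb k hk v => by simp [ha k hk, hb k hk]
      zero_mem' := fun k _ v => by simp
      smul_mem' := fun c T hT k hk v => by simp [hT k hk] }
  apply_mem_toSubmodule g T hT k hk v := by
    have hk' : g⁻¹ * k * g ∈ N := by simpa using hN.conj_mem k hk g⁻¹
    have h1 := hT _ hk' (ρ g⁻¹ v)
    change ρ g (T (ρ g⁻¹ (ρ k v))) = ρ k (ρ g (T (ρ g⁻¹ v)))
    rw [← apply_mul_apply, ← apply_mul_apply k g,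
      show g⁻¹ * k = g⁻¹ * k * g * g⁻¹ by group, apply_mul_apply, h1, ← apply_mul_apply g]
    congr 2
    group

lemma mem_commutant {N : Subgroup G} [N.Normal] {T : Module.End ℂ V} :
    T ∈ (ρ.commutant N).toSubmodule ↔ ∀ n ∈ N, linHom ρ ρ n T = T := by
  have hconj : ∀ g T v, linHom ρ ρ g T v = ρ g (T (ρ g⁻¹ v)) := fun g T v => rfl
  constructor
  · intro hT n hn
    refine LinearMap.ext fun v => ?_
    rw [hconj, ← hT n hn, apply_inv_apply]
  · intro hT n hn v
    conv_lhs => rw [← hT n hn]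
    rw [hconj, ← apply_mul_apply, inv_mul_cancel, map_one, Module.End.one_apply]

/-- The map from `p` copies of `S` to `V` whose range is the sum of the translates `hʲ S`, `j < p`.
-/
def translateSum (ρ : Representation ℂ G V) (h : G) (p : ℕ) (S : Submodule ℂ V) :
    (Fin p → S) →ₗ[ℂ] V :=
  ∑ j : Fin p, ρ (h ^ (j : ℕ)) ∘ₗ S.subtype ∘ₗ LinearMap.proj j

lemma translateSum_apply (h : G) (p : ℕ) (S : Submodule ℂ V) (x : Fin p → S) :
    ρ.translateSum h p S x = ∑ j : Fin p, ρ (h ^ (j : ℕ)) (x j) := by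
  simp [translateSum]

variable [FiniteDimensional ℂ V]

lemma finrank_le_mul_of_stableUnder_index_prime (hρ : ρ.SimpleUnder ⊤ ⊤) {K : Subgroup G}
    [K.Normal] {p : ℕ} (hp : p.Prime) (hK : K.index = p) {S : Submodule ℂ V} (hS0 : S ≠ ⊥)
    (hS : ρ.StableUnder K S) : Module.finrank ℂ V ≤ p * Module.finrank ℂ S := by
  obtain ⟨h, hh⟩ : ∃ h, h ∉ K := by
    by_contra! hcon
    rw [(Subgroup.eq_top_iff' K).2 hcon, Subgroup.index_top] at hK
    exact hp.one_lt.ne hK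
  have hrange : LinearMap.range (ρ.translateSum h p S) = ⊤ := by
    have hmem : ∀ g : G, ∀ s ∈ S, ρ g s ∈ LinearMap.range (ρ.translateSum h p S) := by
      intro g s hs
      obtain ⟨j, k, hk, rfl⟩ := Subgroup.exists_eq_pow_mul_of_index_prime hp hK hh g
      refine ⟨Pi.single j ⟨ρ k s, hS k hk s hs⟩, ?_⟩
      rw [translateSum_apply, Finset.sum_eq_single j]
      · rw [Pi.single_eq_same, apply_mul_apply]
      · intro i _ hij
        rw [Pi.single_eq_of_ne hij]
        simp
      · simp
    refine hρ.eq_of_le _ le_top ?_ ?_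
    · obtain ⟨s, hs, hs0⟩ := (Submodule.ne_bot_iff S).1 hS0
      refine (Submodule.ne_bot_iff _).2 ⟨s, ?_, hs0⟩
      simpa using hmem 1 s hs
    · rintro g - _ ⟨x, rfl⟩
      rw [translateSum_apply, map_sum]
      refine Submodule.sum_mem _ fun j _ => ?_
      rw [← apply_mul_apply]
      exact hmem _ _ (x j).2
  have h1 := LinearMap.finrank_range_le (ρ.translateSum h p S)
  rw [hrange, finrank_top, Module.finrank_pi_fintype] at h1
  simpa using h1

/-- If some endomorphism commutes with `K` but not with `h`, then conjugation by `h` on the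
endomorphisms commuting with `K`, being of finite order and not the identity, has an eigenvector
with eigenvalue different from `1`. -/
lemma exists_commutesWith_twist {K : Subgroup G} [K.Normal] {p : ℕ} (hp : p.Prime)
    {h : G} (hhp : h ^ p ∈ K) {T₀ : Module.End ℂ V} (hT₀ : ρ.CommutesWith K T₀)
    (hT₀h : ¬ ∀ v, T₀ (ρ h v) = ρ h (T₀ v)) :
    ∃ (T : Module.End ℂ V) (ω : ℂ), T ≠ 0 ∧ ω ≠ 1 ∧ ω ^ p = 1 ∧ ρ.CommutesWith K T ∧
      ∀ v, T (ρ h v) = ω • ρ h (T v) := by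
  let E := (ρ.commutant K).toSubmodule
  have hconj : ∀ g T v, linHom ρ ρ g T v = ρ g (T (ρ g⁻¹ v)) := fun g T v => rfl
  have hE : ∀ T ∈ E, linHom ρ ρ h T ∈ E := fun T hT => (ρ.commutant K).apply_mem_toSubmodule h hT
  set c : Module.End ℂ E := (linHom ρ ρ h).restrict hE with hc
  have hcp : c ^ p = 1 := by
    refine LinearMap.ext fun T => Subtype.ext (LinearMap.ext fun v => ?_)
    rw [hc, Module.End.pow_restrict, LinearMap.coe_restrict_apply, ← map_pow, hconj,
      T.2 _ (K.inv_mem hhp), ← apply_mul_apply]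
    simp
  have hss : c.IsSemisimple := by
    refine Module.End.isSemisimple_of_squarefree_aeval_eq_zero (p := Polynomial.X ^ p - 1) ?_ ?_
    · exact (Polynomial.X_pow_sub_one_separable_iff.2 (by exact_mod_cast hp.ne_zero)).squarefree
    · simp [hcp]
  obtain ⟨ζ, hζ1, hζ⟩ : ∃ ζ, ζ ≠ 1 ∧ c.HasEigenvalue ζ := by
    by_contra! hcon
    have htop : Module.End.eigenspace c 1 = ⊤ := by
      rw [eq_top_iff, ← hss.iSup_eigenspace_eq_top]
      refine iSup_le fun ζ => ?_
      by_cases hζ : ζ = 1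
      · rw [hζ]
      · have := hcon ζ hζ
        rw [Module.End.hasEigenvalue_iff, not_not] at this
        rw [this]
        exact bot_le
    refine hT₀h fun v => ?_
    have h1 : (⟨T₀, hT₀⟩ : E) ∈ Module.End.eigenspace c 1 := by
      rw [htop]
      exact Submodule.mem_top
    rw [Module.End.mem_eigenspace_iff, one_smul] at h1
    have h2 := LinearMap.congr_fun (congrArg Subtype.val h1) (ρ h v)
    rw [hc, LinearMap.coe_restrict_apply, hconj, ← apply_mul_apply h⁻¹ h] at h2
    simpa using h2.symm
  obtain ⟨T, hT⟩ := hζ.exists_hasEigenvector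
  have hTc := hT.apply_eq_smul
  have hζp : ζ ^ p = 1 := by
    have h1 := hT.pow_apply p
    rw [hcp, Module.End.one_apply] at h1
    have h2 : (1 : ℂ) • (T : Module.End ℂ V) = ζ ^ p • (T : Module.End ℂ V) := by
      rw [one_smul]
      exact congrArg Subtype.val h1
    exact (smul_left_injective ℂ (fun h0 => hT.2 (Subtype.ext h0)) h2).symm
  have hζ0 : ζ ≠ 0 := by
    rintro rfl
    simp [hp.ne_zero] at hζp
  refine ⟨T, ζ⁻¹, fun h0 => hT.2 (Subtype.ext h0), by simpa using hζ1, by simp [hζp], T.2,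
    fun v => ?_⟩
  have h2 := LinearMap.congr_fun (congrArg Subtype.val hTc) (ρ h v)
  rw [hc, LinearMap.coe_restrict_apply, hconj, ← apply_mul_apply h⁻¹ h] at h2
  rw [eq_inv_smul_iff₀ hζ0]
  simpa using h2.symm

/-- An irreducible representation restricted to a normal subgroup of prime index `p` either stays
irreducible or breaks up into `p` parts of equal dimension. In the second case there is an
endomorphism `T` commuting with `K` with `T h = ω h T` for a primitive `p`-th root of unity `ω`,
and `h` permutes `p` eigenspaces of `T` cyclically. -/
lemma finrank_of_simpleUnder_index_prime [Finite G] (hρ : ρ.SimpleUnder ⊤ ⊤) {K : Subgroup G}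
    [K.Normal] {p : ℕ} (hp : p.Prime) (hK : K.index = p) {S : Submodule ℂ V}
    (hS : ρ.SimpleUnder K S) :
    Module.finrank ℂ V = Module.finrank ℂ S ∨ Module.finrank ℂ V = p * Module.finrank ℂ S := by
  obtain ⟨h, hh⟩ : ∃ h, h ∉ K := by
    by_contra! hcon
    rw [(Subgroup.eq_top_iff' K).2 hcon, Subgroup.index_top] at hK
    exact hp.one_lt.ne hK
  have hhp : h ^ p ∈ K := hK ▸ Subgroup.pow_index_mem_of_normal h
  by_cases hcomm : ∀ T, ρ.CommutesWith K T → ρ.CommutesWith ⊤ T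
  · left
    have h1 := hS.of_commutesWith le_top hcomm
    have h2 := hρ.eq_of_le S le_top h1.ne_bot h1.stable
    rw [h2, finrank_top]
  right
  have hgen : ∀ T : Module.End ℂ V, ρ.CommutesWith K T → (∀ v, T (ρ h v) = ρ h (T v)) →
      ρ.CommutesWith ⊤ T := by
    intro T hT hTh g _ v
    obtain ⟨j, k, hk, rfl⟩ := Subgroup.exists_eq_pow_mul_of_index_prime hp hK hh g
    have hpow : ∀ (j : ℕ) v, T (ρ (h ^ j) v) = ρ (h ^ j) (T v) := by
      intro j
      induction j with
      | zero => simp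
      | succ j ih => intro v; rw [pow_succ, apply_mul_apply, ih, hTh, ← apply_mul_apply]
    rw [apply_mul_apply, apply_mul_apply, hpow, hT k hk]
  push Not at hcomm
  obtain ⟨T₀, hT₀, hT₀'⟩ := hcomm
  obtain ⟨T, ω, hT0, hω1, hωp, hTK, hTh⟩ :=
    exists_commutesWith_twist hp hhp hT₀ fun hc => hT₀' (hgen T₀ hT₀ hc)
  have hω : IsPrimitiveRoot ω p := by
    rw [← orderOf_eq_prime (hp := ⟨hp⟩) hωp hω1]
    exact IsPrimitiveRoot.orderOf ω
  have hpow : ∀ (j : ℕ) v, T (ρ (h ^ j) v) = ω ^ j • ρ (h ^ j) (T v) := by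
    intro j
    induction j with
    | zero => simp
    | succ j ih =>
      intro v
      rw [pow_succ, apply_mul_apply, ih, hTh, map_smul, smul_smul, ← pow_succ, ← apply_mul_apply]
  have hinj : LinearMap.ker T = ⊥ := by
    by_contra hne
    refine hT0 (LinearMap.ker_eq_top.1 (hρ.eq_of_le _ le_top hne ?_))
    intro g _ v hv
    obtain ⟨j, k, hk, rfl⟩ := Subgroup.exists_eq_pow_mul_of_index_prime hp hK hh g
    rw [LinearMap.mem_ker] at hv ⊢
    rw [apply_mul_apply, hpow, hTK k hk, hv, map_zero, map_zero, smul_zero]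
  have : Nontrivial V := by
    by_contra hV
    rw [not_nontrivial_iff_subsingleton] at hV
    exact hρ.ne_bot (Subsingleton.elim _ _)
  obtain ⟨μ, hμ⟩ := Module.End.exists_eigenvalue T
  have hμ0 : μ ≠ 0 := by
    rintro rfl
    rw [Module.End.hasEigenvalue_iff, Module.End.eigenspace_zero] at hμ
    exact hμ hinj
  set X := Module.End.eigenspace T μ with hX
  have hXK : ρ.StableUnder K X := by
    intro k hk v hv
    rw [hX, Module.End.mem_eigenspace_iff] at hv ⊢
    rw [hTK k hk, hv, map_smul]
  -- the translates of `X` by powers of `h` lie in eigenspaces for the distinct values `ωʲ μ`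
  have hlow : p * Module.finrank ℂ X ≤ Module.finrank ℂ V := by
    have hinj' : Function.Injective (ρ.translateSum h p X) := by
      rw [← LinearMap.ker_eq_bot, LinearMap.ker_eq_bot']
      intro x hx
      rw [translateSum_apply] at hx
      have hind : iSupIndep fun j : Fin p => Module.End.eigenspace T (ω ^ (j : ℕ) * μ) := by
        refine (Module.End.eigenspaces_iSupIndep T).comp fun i j hij => ?_
        exact Fin.ext (hω.pow_inj i.2 j.2 (mul_right_cancel₀ hμ0 hij))
      have h0 := (iSupIndep_iff_finsetSum_eq_zero_imp_eq_zero _).1 hind Finset.univ _ ?_ hx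
      · funext j
        have h1 := congrArg (ρ (h ^ (j : ℕ))⁻¹) (h0 j (Finset.mem_univ j))
        rw [← apply_mul_apply, inv_mul_cancel, map_one, map_zero] at h1
        exact Subtype.ext h1
      · intro j _
        have hxj := (x j).2
        replace hxj := Module.End.mem_eigenspace_iff.1 hxj
        rw [Module.End.mem_eigenspace_iff, hpow, hxj, map_smul, smul_smul]
    have h1 := LinearMap.finrank_le_finrank_of_injective hinj'
    rw [Module.finrank_pi_fintype] at h1
    simpa using h1
  -- `dim V ≤ p dim S' ≤ p dim X ≤ dim V`, so any `K`-simple `S'` in `X` has dimension `dim V / p`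
  obtain ⟨S', hS'X, hS'⟩ := hXK.exists_simpleUnder_le hμ
  have h1 := finrank_le_mul_of_stableUnder_index_prime hρ hp hK hS'.ne_bot hS'.stable
  have h2 := Nat.mul_le_mul_left p (Submodule.finrank_mono hS'X)
  rw [finrank_eq_of_simpleUnder_normal hρ hS hS']
  omega

end Representation

/-! ### Normal subgroups of prime power relative index -/

lemma Subgroup.exists_normal_index_prime_ge {G : Type*} [Group G] {K : Subgroup G} [K.Normal]
    {p k : ℕ} (hp : p.Prime) (hK : K.index = p ^ (k + 1)) :
    ∃ L : Subgroup G, L.Normal ∧ K ≤ L ∧ L.index = p := by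
  have : Fact p.Prime := ⟨hp⟩
  have hc : Nat.card (G ⧸ K) = p ^ (k + 1) := hK
  have : Finite (G ⧸ K) := Nat.finite_of_card_ne_zero (by rw [hc]; exact pow_ne_zero _ hp.ne_zero)
  obtain ⟨L, hL⟩ := Sylow.exists_subgroup_card_pow_prime (G := G ⧸ K) p (n := k)
    (by rw [hc]; exact pow_dvd_pow p k.le_succ)
  have hLi : L.index = p := by
    have := L.card_mul_index
    rw [hL, hc, pow_succ] at this
    exact Nat.eq_of_mul_eq_mul_left (pow_pos hp.pos k) this
  have hLn : L.Normal := Subgroup.normal_of_index_eq_minFac_card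
    (by rw [hLi, hc, hp.pow_minFac k.succ_ne_zero])
  refine ⟨L.comap (QuotientGroup.mk' K), inferInstance, ?_, ?_⟩
  · intro x hx
    rw [Subgroup.mem_comap, QuotientGroup.mk'_apply, (QuotientGroup.eq_one_iff x).2 hx]
    exact L.one_mem
  · rw [Subgroup.index_comap_of_surjective _ (QuotientGroup.mk'_surjective K), hLi]

namespace Representation

variable {G V : Type*} [Group G] [AddCommGroup V] [Module ℂ V] {ρ : Representation ℂ G V}

lemma SimpleUnder.toRepresentation {σ : Subrepresentation ρ}
    (hσ : ρ.SimpleUnder ⊤ σ.toSubmodule) : σ.toRepresentation.SimpleUnder ⊤ ⊤ := by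
  have hinj : Function.Injective (Submodule.map σ.toSubmodule.subtype) :=
    Submodule.map_injective_of_injective σ.toSubmodule.injective_subtype
  have htop : (⊤ : Submodule ℂ σ.toSubmodule).map σ.toSubmodule.subtype = σ.toSubmodule := by simp
  have hbot : (⊥ : Submodule ℂ σ.toSubmodule).map σ.toSubmodule.subtype = ⊥ := by simp
  refine ⟨fun h => hσ.ne_bot ?_, fun _ _ _ _ => Submodule.mem_top, fun T _ hT0 hT => ?_⟩
  · rw [← htop, ← hbot]
    exact congrArg _ h
  · refine hinj ((hσ.eq_of_le _ (Submodule.map_subtype_le _ T) ?_ ?_).trans htop.symm)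
    · exact fun h => hT0 (hinj (h.trans hbot.symm))
    · rintro g hg _ ⟨t, ht, rfl⟩
      exact ⟨_, hT g hg t ht, rfl⟩

/-- The representation of `H` on a stable subspace. -/
def StableUnder.restrict {H : Subgroup G} {S : Submodule ℂ V} (hS : ρ.StableUnder H S) :
    Representation ℂ H S :=
  hS.subrep.toRepresentation

lemma SimpleUnder.restrict {H : Subgroup G} {S : Submodule ℂ V}
    (hS : ρ.SimpleUnder H S) : hS.stable.restrict.SimpleUnder ⊤ ⊤ :=
  SimpleUnder.toRepresentation (σ := hS.stable.subrep)
    ⟨hS.ne_bot, fun h _ v hv => hS.stable h h.2 v hv, fun T hT hT0 hTs =>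
      hS.eq_of_le T hT hT0 fun h hh v hv => hTs ⟨h, hh⟩ (Subgroup.mem_top _) v hv⟩

lemma SimpleUnder.map_subtype {H K : Subgroup G} (hKH : K ≤ H) {S : Submodule ℂ V}
    (hS : ρ.StableUnder H S) {T : Submodule ℂ S}
    (hT : hS.restrict.SimpleUnder (K.subgroupOf H) T) :
    ρ.SimpleUnder K (T.map S.subtype) := by
  have hinj : Function.Injective (Submodule.map S.subtype) :=
    Submodule.map_injective_of_injective S.injective_subtype
  have hbot : (⊥ : Submodule ℂ S).map S.subtype = ⊥ := by simp
  refine ⟨fun h => hT.ne_bot (hinj (h.trans hbot.symm)), ?_, fun U hU hU0 hUs => ?_⟩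
  · rintro k hk _ ⟨t, ht, rfl⟩
    exact ⟨_, hT.stable ⟨k, hKH hk⟩ hk t ht, rfl⟩
  · have hUS : (U.comap S.subtype).map S.subtype = U := by
      rw [Submodule.map_comap_subtype]
      exact inf_eq_right.2 (hU.trans (Submodule.map_subtype_le S T))
    have h1 : U.comap S.subtype = T := by
      refine hT.eq_of_le _ ?_ ?_ ?_
      · intro x hx
        obtain ⟨t, ht, htx⟩ := hU hx
        rwa [← Subtype.ext htx]
      · intro h
        rw [h, hbot] at hUS
        exact hU0 hUS.symm
      · rintro ⟨k, hkH⟩ hk x hx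
        exact hUs k hk _ hx
    rw [← hUS, h1]

lemma SimpleUnder.nontrivial {H : Subgroup G} {S : Submodule ℂ V} (hS : ρ.SimpleUnder H S) :
    Nontrivial S :=
  Submodule.nontrivial_iff_ne_bot.2 hS.ne_bot

/-- Restricting an irreducible representation to a normal subgroup of `p`-power index divides the
degree by a power of `p`. -/
lemma finrank_of_simpleUnder_index_prime_pow {p : ℕ} (hp : p.Prime) (k : ℕ) :
    ∀ {G : Type*} {V : Type*} [Group G] [Finite G] [AddCommGroup V] [Module ℂ V]
      [FiniteDimensional ℂ V] {ρ : Representation ℂ G V}, ρ.SimpleUnder ⊤ ⊤ →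
      ∀ {K : Subgroup G} [K.Normal], K.index = p ^ k → ∀ {S : Submodule ℂ V},
      ρ.SimpleUnder K S → ∃ j, Module.finrank ℂ V = p ^ j * Module.finrank ℂ S := by
  induction k with
  | zero =>
    intro G V _ _ _ _ _ ρ hρ K _ hK S hS
    rw [pow_zero, Subgroup.index_eq_one] at hK
    subst hK
    refine ⟨0, ?_⟩
    rw [hρ.eq_of_le S le_top hS.ne_bot hS.stable, finrank_top, pow_zero, one_mul]
  | succ k ih =>
    intro G V _ _ _ _ _ ρ hρ K _ hK S hS
    obtain ⟨L, hL, hKL, hLp⟩ := Subgroup.exists_normal_index_prime_ge hp hK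
    have hV : Nontrivial V := by
      have := hS.nontrivial
      exact S.injective_subtype.nontrivial
    obtain ⟨S', hS'⟩ := exists_simpleUnder ρ L
    have := hS'.nontrivial
    obtain ⟨T, hT⟩ := exists_simpleUnder hS'.stable.restrict (K.subgroupOf L)
    have hidx : (K.subgroupOf L).index = p ^ k := by
      have h1 := Subgroup.relIndex_mul_index hKL
      rw [hK, hLp, pow_succ] at h1
      exact Nat.eq_of_mul_eq_mul_right hp.pos h1
    obtain ⟨j, hj⟩ := ih hS'.restrict hidx hT
    have h2 := finrank_eq_of_simpleUnder_normal hρ hS (SimpleUnder.map_subtype hKL hS'.stable hT)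
    rw [LinearEquiv.finrank_eq (Submodule.equivMapOfInjective _ S'.injective_subtype T).symm] at h2
    rw [h2]
    rcases finrank_of_simpleUnder_index_prime hρ hp hLp hS' with h3 | h3
    · exact ⟨j, h3.trans hj⟩
    · exact ⟨j + 1, by rw [h3, pow_succ', mul_assoc]; exact congrArg _ hj⟩

variable [Finite G] [FiniteDimensional ℂ V]

lemma finrank_of_simpleUnder_relIndex_prime_pow (hρ : ρ.SimpleUnder ⊤ ⊤) {N M : Subgroup G}
    [N.Normal] (hNM : N ≤ M) {p k : ℕ} (hp : p.Prime) (hidx : N.relIndex M = p ^ k)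
    {S T : Submodule ℂ V} (hS : ρ.SimpleUnder M S) (hT : ρ.SimpleUnder N T) :
    ∃ j, Module.finrank ℂ S = p ^ j * Module.finrank ℂ T := by
  have := hS.nontrivial
  obtain ⟨T', hT'⟩ := exists_simpleUnder hS.stable.restrict (N.subgroupOf M)
  obtain ⟨j, hj⟩ := finrank_of_simpleUnder_index_prime_pow hp k hS.restrict hidx hT'
  have h2 := finrank_eq_of_simpleUnder_normal hρ hT (SimpleUnder.map_subtype hNM hS.stable hT')
  rw [LinearEquiv.finrank_eq (Submodule.equivMapOfInjective _ S.injective_subtype T').symm] at h2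
  exact ⟨j, h2 ▸ hj⟩

lemma finrank_of_simpleUnder_relIndex_prime (hρ : ρ.SimpleUnder ⊤ ⊤) {N M : Subgroup G}
    [N.Normal] (hNM : N ≤ M) {p : ℕ} (hp : p.Prime) (hidx : N.relIndex M = p)
    {S T : Submodule ℂ V} (hS : ρ.SimpleUnder M S) (hT : ρ.SimpleUnder N T) :
    Module.finrank ℂ S = Module.finrank ℂ T ∨
      Module.finrank ℂ S = p * Module.finrank ℂ T := by
  have := hS.nontrivial
  obtain ⟨T', hT'⟩ := exists_simpleUnder hS.stable.restrict (N.subgroupOf M)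
  have hj := finrank_of_simpleUnder_index_prime hS.restrict hp hidx hT'
  have h2 := finrank_eq_of_simpleUnder_normal hρ hT (SimpleUnder.map_subtype hNM hS.stable hT')
  rw [LinearEquiv.finrank_eq (Submodule.equivMapOfInjective _ S.injective_subtype T').symm] at h2
  exact h2 ▸ hj

omit [Finite G] in
/-- If every endomorphism commutes with `N`, then `N` stabilizes every line, so a line in an
eigenspace of a generator of `M` modulo `N` is `M`-stable. -/
lemma exists_simpleUnder_finrank_one [Nontrivial V] {N M : Subgroup G} [N.Normal]
    {p : ℕ} (hp : p.Prime) (hidx : N.relIndex M = p)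
    (hcomm : ∀ T, ρ.CommutesWith N T) :
    ∃ S : Submodule ℂ V, ρ.SimpleUnder M S ∧ Module.finrank ℂ S = 1 := by
  obtain ⟨h, hh⟩ : ∃ h : M, h ∉ N.subgroupOf M := by
    by_contra! hcon
    rw [Subgroup.relIndex, (Subgroup.eq_top_iff' _).2 hcon, Subgroup.index_top] at hidx
    exact hp.one_lt.ne hidx
  obtain ⟨μ, hμ⟩ := Module.End.exists_eigenvalue (ρ h)
  obtain ⟨v, hv⟩ := hμ.exists_hasEigenvector
  have h1 : Module.finrank ℂ (ℂ ∙ v) = 1 := finrank_span_singleton hv.2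
  refine ⟨ℂ ∙ v, simpleUnder_of_finrank_eq_one ?_ h1, h1⟩
  have hN : ∀ n ∈ N, ∀ w ∈ ℂ ∙ v, ρ n w ∈ ℂ ∙ v := by
    intro n hn w hw
    obtain ⟨C, hC⟩ := Submodule.exists_isCompl (ℂ ∙ v)
    have h2 := Submodule.projection_apply_left hC ⟨w, hw⟩
    simp only at h2
    rw [← h2, ← hcomm _ n hn]
    exact Submodule.projection_apply_mem hC _
  have hpow : ∀ j : ℕ, ∀ w ∈ ℂ ∙ v, ρ ((h : G) ^ j) w ∈ ℂ ∙ v := by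
    intro j
    induction j with
    | zero => intro w hw; simpa using hw
    | succ j ih =>
      intro w hw
      rw [pow_succ, apply_mul_apply]
      refine ih _ ?_
      obtain ⟨c, rfl⟩ := Submodule.mem_span_singleton.1 hw
      rw [map_smul, hv.apply_eq_smul]
      exact Submodule.smul_mem _ _ (Submodule.smul_mem _ _ (Submodule.mem_span_singleton_self v))
  intro m hm w hw
  obtain ⟨j, k, hk, hmj⟩ := Subgroup.exists_eq_pow_mul_of_index_prime hp hidx hh ⟨m, hm⟩
  have hmj' : m = (h : G) ^ (j : ℕ) * k := congrArg Subtype.val hmj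
  rw [hmj', apply_mul_apply]
  exact hpow _ _ (hN _ hk _ hw)

end Representation

/-! ### Characters -/

namespace Representation

variable {G V : Type*} [Group G] [AddCommGroup V] [Module ℂ V] {ρ : Representation ℂ G V}

lemma simpleUnder_top_iff : ρ.SimpleUnder ⊤ ⊤ ↔ ρ.IsIrreducible := by
  constructor
  · intro h
    refine { exists_pair_ne := ⟨⊥, ⊤, fun he => h.ne_bot ?_⟩, eq_bot_or_eq_top := fun σ => ?_ }
    · exact (congrArg Subrepresentation.toSubmodule he).symm
    · refine or_iff_not_imp_left.2 fun hσ => Subrepresentation.toSubmodule_injective ?_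
      refine h.eq_of_le _ le_top (fun h0 => hσ ?_) fun g _ v hv => σ.apply_mem_toSubmodule g hv
      exact Subrepresentation.toSubmodule_injective h0
  · intro h
    refine ⟨fun he => ?_, fun _ _ _ _ => Submodule.mem_top, fun T _ hT0 hT => ?_⟩
    · refine (bot_ne_top (α := Subrepresentation ρ)) ?_
      exact Subrepresentation.toSubmodule_injective he.symm
    · rcases h.eq_bot_or_eq_top ⟨T, fun g v hv => hT g (Subgroup.mem_top g) v hv⟩ with h1 | h1
      · exact absurd (congrArg Subrepresentation.toSubmodule h1) hT0
      · exact congrArg Subrepresentation.toSubmodule h1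

/-- The character of an irreducible representation on any finite-dimensional space is in `Irr G`. -/
lemma character_mem_Irr [FiniteDimensional ℂ V] (hρ : ρ.IsIrreducible) : ρ.character ∈ Irr G := by
  let e : V ≃ₗ[ℂ] (Fin (Module.finrank ℂ V) → ℂ) := (Module.finBasis ℂ V).equivFun
  let σ : Representation ℂ G (Fin (Module.finrank ℂ V) → ℂ) :=
    { toFun := fun g => e.conj (ρ g)
      map_one' := by rw [map_one]; exact e.conj_id
      map_mul' := fun g h => by rw [map_mul]; exact e.conj_comp _ _ }
  refine ⟨_, σ, ?_, ?_⟩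
  · rw [← simpleUnder_top_iff] at hρ ⊢
    refine ⟨fun h => hρ.ne_bot ?_, fun _ _ _ _ => Submodule.mem_top, fun T _ hT0 hT => ?_⟩
    · rw [eq_bot_iff]
      intro v _
      have : e v ∈ (⊤ : Submodule ℂ (Fin (Module.finrank ℂ V) → ℂ)) := Submodule.mem_top
      rw [h, Submodule.mem_bot] at this
      simpa using this
    · have h1 : T.comap (e : V →ₗ[ℂ] _) = ⊤ := by
        refine hρ.eq_of_le _ le_top (fun h0 => hT0 ?_) fun g hg v hv => ?_
        · rw [eq_bot_iff]
          intro w hw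
          have : e.symm w ∈ T.comap (e : V →ₗ[ℂ] _) := by simpa using hw
          rw [h0, Submodule.mem_bot] at this
          simpa using this
        · have h2 := hT g hg (e v) hv
          have h3 : σ g (e v) = e (ρ g v) := by
            change e (ρ g (e.symm (e v))) = _
            rw [e.symm_apply_apply]
          rwa [h3] at h2
      rw [eq_top_iff]
      intro w _
      have : e.symm w ∈ T.comap (e : V →ₗ[ℂ] _) := by rw [h1]; exact Submodule.mem_top
      simpa using this
  · funext g
    exact LinearMap.trace_conj' (ρ g) e

open scoped ComplexOrder in
/-- The conjugate of a character value is the value at the inverse, because `G` preserves a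
positive definite hermitian form `A = ∑ ρ(g)ᴴ ρ(g)`. -/
lemma conj_character [Finite G] [FiniteDimensional ℂ V] (ρ : Representation ℂ G V) (g : G) :
    conj (ρ.character g) = ρ.character g⁻¹ := by
  classical
  have := Fintype.ofFinite G
  let b := Module.finBasis ℂ V
  let m : G → Matrix (Fin _) (Fin _) ℂ := fun g => LinearMap.toMatrixAlgEquiv b (ρ g)
  have hmul : ∀ g h, m (g * h) = m g * m h := fun g h => by simp only [m, map_mul]
  have hone : m 1 = 1 := by simp only [m, map_one]
  have htr : ∀ g, ρ.character g = (m g).trace := fun g => LinearMap.trace_eq_matrix_trace ℂ b _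
  have hunit : ∀ g, m g * m g⁻¹ = 1 := fun g => by rw [← hmul, mul_inv_cancel, hone]
  let A := ∑ g : G, (m g).conjTranspose * m g
  have hA : A.PosDef := by
    rw [show A = _ from (Finset.add_sum_erase _ _ (Finset.mem_univ 1)).symm, hone,
      Matrix.conjTranspose_one, one_mul]
    exact Matrix.PosDef.one.add_posSemidef
      (Matrix.posSemidef_sum _ fun g _ => Matrix.posSemidef_conjTranspose_mul_self _)
  have hinv : ∀ g, (m g).conjTranspose * A * m g = A := by
    intro g
    simp only [A, Finset.mul_sum, Finset.sum_mul]
    refine Fintype.sum_equiv (Equiv.mulRight g) _ _ fun h => ?_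
    simp only [Equiv.coe_mulRight, hmul, Matrix.conjTranspose_mul, Matrix.mul_assoc]
  have hAu := hA.isUnit
  have hdet := (Matrix.isUnit_iff_isUnit_det A).1 hAu
  have h1 : (m g).conjTranspose = A * m g⁻¹ * A⁻¹ := by
    calc (m g).conjTranspose = (m g).conjTranspose * A * (m g * m g⁻¹) * A⁻¹ := by
          rw [hunit, mul_one, Matrix.mul_assoc, Matrix.mul_nonsing_inv A hdet, mul_one]
      _ = A * m g⁻¹ * A⁻¹ := by rw [← Matrix.mul_assoc _ (m g), hinv]
  rw [htr, htr, starRingEnd_apply, ← Matrix.trace_conjTranspose, h1, Matrix.trace_mul_comm,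
    Matrix.nonsing_inv_mul_cancel_left _ _ hdet]

variable [Fintype G]

lemma charInner_character {W : Type*} [AddCommGroup W] [Module ℂ W] [FiniteDimensional ℂ V]
    [FiniteDimensional ℂ W] {τ : Representation ℂ G W} :
    charInner ρ.character τ.character = Module.finrank ℂ (IntertwiningMap τ ρ) := by
  have : Invertible (Nat.card G : ℂ) := invertibleOfNonzero (by simp)
  rw [← card_inv_mul_sum_char_mul_char_eq_finrank, charInner, Nat.card_eq_fintype_card]
  simp only [conj_character]

end Representation

/-- Finiteness keeps `Set.ncard` from taking its junk value `0` in `eta`. It holds because distinct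
irreducible characters are orthogonal, hence linearly independent, in a finite-dimensional space.
-/
lemma Irr_finite (G : Type*) [Group G] [Finite G] : (Irr G).Finite := by
  have := Fintype.ofFinite G
  have horth : ∀ α ∈ Irr G, ∀ β ∈ Irr G, α ≠ β → charInner α β = 0 := by
    rintro _ ⟨n, ρ, hρ, rfl⟩ _ ⟨m, τ, hτ, rfl⟩ hne
    have : IsEmpty (Representation.Equiv τ ρ) := ⟨fun e => hne (Representation.char_iso e).symm⟩
    rw [Representation.charInner_character, Module.finrank_zero_of_subsingleton, Nat.cast_zero]
  have hself : ∀ α ∈ Irr G, charInner α α ≠ 0 := by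
    rintro _ ⟨n, ρ, hρ, rfl⟩
    rw [Representation.charInner_character,
      Representation.IsIrreducible.finrank_intertwiningMap_self]
    simp
  have hli : LinearIndependent ℂ (Subtype.val : Irr G → G → ℂ) := by
    rw [linearIndependent_iff']
    intro s c hc β hβ
    have h1 : charInner (∑ α ∈ s, c α • (α : G → ℂ)) β = c β * charInner (β : G → ℂ) β := by
      have h2 : charInner (∑ α ∈ s, c α • (α : G → ℂ)) β =
          ∑ α ∈ s, c α * charInner (α : G → ℂ) β := by
        simp only [charInner, Finset.sum_apply, Pi.smul_apply, smul_eq_mul, Finset.sum_mul,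
          Finset.mul_sum]
        rw [Finset.sum_comm]
        refine Finset.sum_congr rfl fun _ _ => Finset.sum_congr rfl fun _ _ => by ring
      rw [h2]
      refine Finset.sum_eq_single_of_mem β hβ fun α _ hα => ?_
      rw [horth α α.2 β β.2 fun h => hα (Subtype.ext h), mul_zero]
    rw [hc] at h1
    have h3 : charInner (0 : G → ℂ) β = 0 := by simp [charInner]
    exact (mul_eq_zero.1 (h1.symm.trans h3)).resolve_right (hself β β.2)
  exact hli.setFinite

lemma finite_nonprincipalConstituents {G : Type*} [Group G] [Fintype G] (χ : G → ℂ) :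
    (nonprincipalConstituents χ).Finite :=
  (Irr_finite G).subset fun _ h => h.1

/-! ### Descending steps in solvable and supersolvable groups -/

/-- In a finite group, a normal abelian subgroup `A ≠ 1` properly contains the subgroup of its
`p`-th powers, for any prime `p` dividing its order. -/
lemma Subgroup.exists_normal_lt_pow_mem {Q : Type*} [Group Q] [Finite Q] {A : Subgroup Q}
    [hA : A.Normal] (hA1 : A ≠ ⊥) (hcomm : ∀ a ∈ A, ∀ b ∈ A, a * b = b * a) :
    ∃ (p : ℕ) (R : Subgroup Q), p.Prime ∧ R.Normal ∧ R < A ∧ (∀ a ∈ A, a ^ p ∈ R) ∧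
      (IsCyclic A → R.relIndex A = p) := by
  let _ : CommGroup A := { (inferInstance : Group A) with
    mul_comm := fun a b => Subtype.ext (hcomm a a.2 b b.2) }
  have hcard : Nat.card A ≠ 1 := fun h => hA1 (Subgroup.card_eq_one.1 h)
  obtain ⟨p, hp, hpA⟩ := Nat.exists_prime_and_dvd hcard
  have : Fact p.Prime := ⟨hp⟩
  set f : A →* A := powMonoidHom p with hf
  have hker : f.range ≠ ⊤ := by
    intro htop
    obtain ⟨a, ha⟩ := exists_prime_orderOf_dvd_card' p hpA
    have hinj := Finite.injective_iff_surjective.2 (MonoidHom.range_eq_top.1 htop)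
    have : a = 1 := hinj (by rw [hf, powMonoidHom_apply, ← ha, pow_orderOf_eq_one, map_one])
    rw [this, orderOf_one] at ha
    exact hp.one_lt.ne ha
  have hle : f.range.map A.subtype ≤ A := Subgroup.map_subtype_le _
  have hsub : (f.range.map A.subtype).subgroupOf A = f.range :=
    Subgroup.comap_map_eq_self_of_injective A.subtype_injective _
  refine ⟨p, f.range.map A.subtype, hp, ⟨?_⟩, lt_of_le_of_ne hle ?_, ?_, ?_⟩
  · rintro _ ⟨_, ⟨a, rfl⟩, rfl⟩ g
    refine ⟨_, ⟨⟨g * a * g⁻¹, hA.conj_mem a a.2 g⟩, rfl⟩, ?_⟩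
    simp [hf]
  · intro h
    rw [h, Subgroup.subgroupOf_self] at hsub
    exact hker hsub.symm
  · exact fun a ha => ⟨_, ⟨⟨a, ha⟩, rfl⟩, rfl⟩
  · intro hcyc
    rw [Subgroup.relIndex, hsub]
    have h1 := f.range.card_mul_index
    have h2 : Nat.card f.range = Nat.card A / p := by
      rw [hf, IsCyclic.card_powMonoidHom_range, Nat.gcd_eq_right hpA]
    rw [h2] at h1
    have h3 := Nat.div_mul_cancel hpA
    have h4 : 0 < Nat.card A / p := Nat.div_pos (Nat.le_of_dvd Nat.card_pos hpA) hp.pos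
    exact Nat.eq_of_mul_eq_mul_left h4 (h1.trans h3.symm)

lemma Subgroup.exists_normal_lt_of_commutator_le {G : Type*} [Group G] [Finite G]
    {K M : Subgroup G} [K.Normal] [M.Normal] (hKM : K < M) (hcomm : ⁅M, M⁆ ≤ K) :
    ∃ (p k : ℕ) (N : Subgroup G), p.Prime ∧ N.Normal ∧ N < M ∧ N.relIndex M = p ^ k ∧
      (IsCyclic (M.map (QuotientGroup.mk' K)) → N.relIndex M = p) := by
  set π := QuotientGroup.mk' K with hπ
  have hsurj : Function.Surjective π := QuotientGroup.mk'_surjective K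
  have hMn : (M.map π).Normal := Subgroup.Normal.map inferInstance π hsurj
  have hker : π.ker ≤ M := by rw [hπ, QuotientGroup.ker_mk']; exact hKM.le
  have hcm : (M.map π).comap π = M := Subgroup.comap_map_eq_self hker
  obtain ⟨p, R, hp, hR, hRM, hpow, hcyc⟩ := Subgroup.exists_normal_lt_pow_mem (A := M.map π)
    (by
      intro h
      rw [Subgroup.map_eq_bot_iff, hπ, QuotientGroup.ker_mk'] at h
      exact hKM.not_ge h)
    (by
      rintro _ ⟨a, ha, rfl⟩ _ ⟨b, hb, rfl⟩
      rw [← commutatorElement_eq_one_iff_mul_comm, ← map_commutatorElement]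
      exact (QuotientGroup.eq_one_iff _).2 (hcomm (Subgroup.commutator_mem_commutator ha hb)))
  have : Fact p.Prime := ⟨hp⟩
  have hrel : (R.comap π).relIndex M = R.relIndex (M.map π) := Subgroup.relIndex_comap _ _ _
  have hNM : R.comap π < M := by
    conv_rhs => rw [← hcm]
    exact (Subgroup.comap_lt_comap_of_surjective hsurj).2 hRM
  have hpg : IsPGroup p (M ⧸ (R.comap π).subgroupOf M) := by
    intro x
    obtain ⟨m, rfl⟩ := QuotientGroup.mk_surjective x
    refine ⟨1, ?_⟩
    rw [pow_one, ← QuotientGroup.mk_pow, QuotientGroup.eq_one_iff, Subgroup.mem_subgroupOf,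
      Subgroup.mem_comap]
    simpa using hpow _ ⟨m, m.2, rfl⟩
  obtain ⟨k, hk⟩ := IsPGroup.iff_card.1 hpg
  exact ⟨p, k, R.comap π, hp, inferInstance, hNM, hk, fun h => hrel.trans (hcyc h)⟩

lemma Subgroup.exists_normal_lt_of_isSolvable {G : Type*} [Group G] [Finite G]
    [Group.IsSolvable G] {M : Subgroup G} [M.Normal] (hM : M ≠ ⊥) :
    ∃ (p k : ℕ) (N : Subgroup G), p.Prime ∧ N.Normal ∧ N < M ∧ N.relIndex M = p ^ k := by
  have hlt : ⁅M, M⁆ < M := Group.IsSolvable.commutator_lt_of_ne_bot hM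
  obtain ⟨p, k, N, hp, hN, hNM, hk, -⟩ := Subgroup.exists_normal_lt_of_commutator_le hlt le_rfl
  exact ⟨p, k, N, hp, hN, hNM, hk⟩

lemma IsSupersolvable.exists_normal_lt {G : Type*} [Group G] [Finite G]
    (hG : IsSupersolvable G) {M : Subgroup G} [M.Normal] (hM : M ≠ ⊥) :
    ∃ (p : ℕ) (N : Subgroup G), p.Prime ∧ N.Normal ∧ N < M ∧ N.relIndex M = p := by
  obtain ⟨n, S, hS, h0, hn, hstep⟩ := hG
  obtain ⟨i, hi, hMi, hMi'⟩ : ∃ i < n, M ≤ S (i + 1) ∧ ¬ M ≤ S i := by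
    by_contra! hcon
    refine hM (le_bot_iff.1 (h0 ▸ ?_))
    have : ∀ j ≤ n, M ≤ S (n - j) := by
      intro j
      induction j with
      | zero => intro _; rw [Nat.sub_zero, hn]; exact le_top
      | succ j ih =>
        intro hj
        refine hcon _ (by omega) ?_
        rw [show n - (j + 1) + 1 = n - j by omega]
        exact ih (by omega)
    simpa using this n le_rfl
  obtain ⟨hle, hcyc⟩ := hstep i hi
  have := hS i
  have hlt : M ⊓ S i < M := inf_lt_left.2 hMi'
  let f : M →* S (i + 1) ⧸ (S i).subgroupOf (S (i + 1)) :=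
    (QuotientGroup.mk' _).comp (Subgroup.inclusion hMi)
  have hf : ∀ m : M, f m = 1 ↔ (m : G) ∈ S i := fun m =>
    (QuotientGroup.eq_one_iff _).trans Subgroup.mem_subgroupOf
  obtain ⟨⟨_, m, rfl⟩, hm⟩ := (inferInstance : IsCyclic f.range).exists_generator
  have hgen : ∀ x : M, ∃ j : ℤ, (m : G) ^ j * (x : G)⁻¹ ∈ M ⊓ S i := by
    intro x
    obtain ⟨j, hj⟩ := Subgroup.mem_zpowers_iff.1 (hm ⟨f x, x, rfl⟩)
    have hj' : f m ^ j = f x := congrArg Subtype.val hj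
    have h1 : f (m ^ j * x⁻¹) = 1 := by rw [map_mul, map_zpow, hj', map_inv, mul_inv_cancel]
    exact ⟨j, (m ^ j * x⁻¹).2, (hf _).1 h1⟩
  have hcycM : IsCyclic (M.map (QuotientGroup.mk' (M ⊓ S i))) := by
    refine ⟨⟨_, m, m.2, rfl⟩, ?_⟩
    rintro ⟨_, x, hx, rfl⟩
    obtain ⟨j, hj⟩ := hgen ⟨x, hx⟩
    refine ⟨j, Subtype.ext ?_⟩
    have h1 := (QuotientGroup.eq_one_iff _).2 hj
    rw [QuotientGroup.mk_mul, QuotientGroup.mk_inv, mul_inv_eq_one] at h1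
    simpa using h1
  obtain ⟨p, k, N, hp, hN, hNM, -, hk⟩ := Subgroup.exists_normal_lt_of_commutator_le hlt (by
    rw [Subgroup.commutator_le]
    intro x hx y hy
    have h1 := hcycM.commGroup.mul_comm ⟨_, x, hx, rfl⟩ ⟨_, y, hy, rfl⟩
    have h2 : (x : G ⧸ M ⊓ S i) * y = y * x := congrArg Subtype.val h1
    rw [← QuotientGroup.eq_one_iff]
    exact commutatorElement_eq_one_iff_mul_comm.2 h2)
  exact ⟨p, N, hp, hN, hNM, hk hcycM⟩

/-! ### Constituents trivial on a normal subgroup, and the count of primes -/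

/-- The non-principal irreducible constituents of `χ * conj χ` whose kernel contains `N`. -/
def constituentsOver {G : Type*} [Group G] [Fintype G] (χ : G → ℂ) (N : Subgroup G) :
    Set (G → ℂ) :=
  {α | α ∈ nonprincipalConstituents χ ∧ ∀ n ∈ N, α n = α 1}

section
variable {G : Type*} [Group G] [Fintype G]

lemma constituentsOver_anti (χ : G → ℂ) {N M : Subgroup G} (hNM : N ≤ M) :
    constituentsOver χ M ⊆ constituentsOver χ N :=
  fun _ h => ⟨h.1, fun n hn => h.2 n (hNM hn)⟩

lemma finite_constituentsOver (χ : G → ℂ) (N : Subgroup G) : (constituentsOver χ N).Finite :=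
  (finite_nonprincipalConstituents χ).subset fun _ h => h.1

lemma ncard_constituentsOver_le_eta (χ : G → ℂ) (N : Subgroup G) :
    (constituentsOver χ N).ncard ≤ eta χ :=
  Set.ncard_le_ncard (fun _ h => h.1) (finite_nonprincipalConstituents χ)

end

namespace Representation

variable {G V : Type*} [Group G] [Fintype G] [AddCommGroup V] [Module ℂ V]
  [FiniteDimensional ℂ V] {ρ : Representation ℂ G V}

/-- Inside a complement of the commutant of `M` in that of `N` there is an irreducible
subrepresentation of `End V`, on which `N` acts trivially and `M` has no fixed vectors; its
character sums to `0` over `M`, so it is a constituent of `χ * conj χ` over `N` but not over `M`. -/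
lemma constituentsOver_ssubset {N M : Subgroup G} [N.Normal] [M.Normal] (hNM : N ≤ M)
    {T : Module.End ℂ V} (hTN : ρ.CommutesWith N T) (hTM : ¬ ρ.CommutesWith M T) :
    constituentsOver ρ.character M ⊂ constituentsOver ρ.character N := by
  obtain ⟨C, hC⟩ := exists_isCompl (ρ.commutant M)
  have hdisj : ∀ x ∈ (ρ.commutant M).toSubmodule, x ∈ C.toSubmodule → x = 0 := by
    intro x hx hx'
    have h1 := congrArg Subrepresentation.toSubmodule hC.inf_eq_bot
    have h2 : x ∈ (ρ.commutant M ⊓ C).toSubmodule := ⟨hx, hx'⟩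
    rw [h1] at h2
    exact h2
  have hsup : T ∈ (ρ.commutant M).toSubmodule ⊔ C.toSubmodule := by
    have h1 := congrArg Subrepresentation.toSubmodule hC.sup_eq_top
    rw [Subrepresentation.toSubmodule_sup] at h1
    rw [h1]
    exact Submodule.mem_top
  obtain ⟨a, ha, b, hb, hab⟩ := Submodule.mem_sup.1 hsup
  have hbN : b ∈ (ρ.commutant N).toSubmodule := by
    have h1 : b = T - a := by rw [← hab, add_sub_cancel_left]
    rw [h1]
    exact Submodule.sub_mem _ hTN (CommutesWith.mono hNM ha)
  have hb0 : b ≠ 0 := by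
    rintro rfl
    rw [add_zero] at hab
    exact hTM (hab ▸ ha)
  let X : Subrepresentation (linHom ρ ρ) := ρ.commutant N ⊓ C
  have hX0 : X.toSubmodule ≠ ⊥ := (Submodule.ne_bot_iff _).2 ⟨b, ⟨hbN, hb⟩, hb0⟩
  have hXs : (linHom ρ ρ).StableUnder ⊤ X.toSubmodule :=
    fun g _ v hv => X.apply_mem_toSubmodule g hv
  obtain ⟨U, hUX, hU⟩ := hXs.exists_simpleUnder_le hX0
  let U' : Subrepresentation (linHom ρ ρ) := ⟨U, fun g v hv => hU.stable g (Subgroup.mem_top g) v hv⟩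
  let τ : Representation ℂ G U := U'.toRepresentation
  have hτv : ∀ g (u : U), ((τ g u : U) : Module.End ℂ V) = linHom ρ ρ g u := fun g u => rfl
  have hτ : τ.IsIrreducible := simpleUnder_top_iff.1 (SimpleUnder.toRepresentation (σ := U') hU)
  have hτN : ∀ n ∈ N, τ.character n = τ.character 1 := by
    intro n hn
    have h1 : τ n = τ 1 := by
      refine LinearMap.ext fun u => Subtype.ext ?_
      rw [hτv, mem_commutant.1 (hUX u.2).1 n hn, map_one, Module.End.one_apply]
    rw [character, character, h1]
  have hτM : ¬ ∀ m ∈ M, τ.character m = τ.character 1 := by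
    intro hcon
    have : Fintype M := Fintype.ofFinite M
    have : Invertible (Nat.card M : ℂ) := invertibleOfNonzero (by simp)
    have h1 := card_inv_mul_sum_char_eq_finrank (τ.comp M.subtype : Representation ℂ M U)
    have h2 : invariants (τ.comp M.subtype : Representation ℂ M U) = ⊥ := by
      rw [Submodule.eq_bot_iff]
      intro u hu
      refine Subtype.ext (hdisj u (mem_commutant.2 fun m hm => ?_) (hUX u.2).2)
      rw [← hτv]
      exact congrArg Subtype.val (hu ⟨m, hm⟩)
    have h3 : ∀ m : M, character (τ.comp M.subtype : Representation ℂ M U) m = τ.character 1 :=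
      fun m => hcon m m.2
    rw [h2, finrank_bot, Finset.sum_congr rfl fun m _ => h3 m, char_one] at h1
    have := hU.nontrivial
    have h4 := (Module.finrank_pos (R := ℂ) (M := U)).ne'
    simp [h4] at h1
  have hτ1 : τ.character ≠ 1 := fun h => hτM fun m _ => by rw [h, Pi.one_apply, Pi.one_apply]
  have hχ : (fun g => ρ.character g * conj (ρ.character g)) = (linHom ρ ρ).character := by
    funext g
    rw [char_linHom, conj_character, mul_comm]
  have hinner : charInner (linHom ρ ρ).character τ.character ≠ 0 := by
    rw [charInner_character]
    intro h0
    rw [Nat.cast_eq_zero] at h0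
    have : Subsingleton (IntertwiningMap τ (linHom ρ ρ)) := Module.finrank_zero_iff.1 h0
    let ι : IntertwiningMap τ (linHom ρ ρ) := ⟨U.subtype, fun g => rfl⟩
    have hι := Subsingleton.elim ι 0
    obtain ⟨u, hu, hu0⟩ := (Submodule.ne_bot_iff U).1 hU.ne_bot
    exact hu0 (congrArg (fun f : IntertwiningMap τ (linHom ρ ρ) => f.toLinearMap ⟨u, hu⟩) hι)
  have hmem : τ.character ∈ nonprincipalConstituents ρ.character :=
    ⟨character_mem_Irr hτ, hτ1, by rw [hχ]; exact hinner⟩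
  exact ⟨constituentsOver_anti _ hNM, fun h => hτM (h ⟨hmem, hτN⟩).2⟩

omit [Fintype G] [FiniteDimensional ℂ V] in
lemma SimpleUnder.finrank_eq_one_of_bot {S : Submodule ℂ V} (hS : ρ.SimpleUnder ⊥ S) :
    Module.finrank ℂ S = 1 := by
  obtain ⟨v, hv, hv0⟩ := (Submodule.ne_bot_iff S).1 hS.ne_bot
  rw [← hS.eq_of_le (ℂ ∙ v) ((Submodule.span_singleton_le_iff_mem _ _).2 hv)
    (by simpa using hv0) fun g hg w hw => by rw [Subgroup.mem_bot.1 hg]; simpa using hw]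
  exact finrank_span_singleton hv0

/-- Either the degree of the irreducible constituents is the same over `N` and `M`, or some
constituent of `χ * conj χ` over `N` is not one over `M`. -/
lemma finrank_eq_or_constituentsOver_ssubset (hρ : ρ.SimpleUnder ⊤ ⊤) {N M : Subgroup G}
    [N.Normal] [M.Normal] (hNM : N ≤ M) {S T : Submodule ℂ V} (hS : ρ.SimpleUnder M S)
    (hT : ρ.SimpleUnder N T) : Module.finrank ℂ S = Module.finrank ℂ T ∨
      constituentsOver ρ.character M ⊂ constituentsOver ρ.character N := by
  by_cases hcomm : ∀ T, ρ.CommutesWith N T → ρ.CommutesWith M T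
  · exact .inl (finrank_eq_of_simpleUnder_normal hρ hS (hT.of_commutesWith hNM hcomm))
  · push Not at hcomm
    obtain ⟨E, hEN, hEM⟩ := hcomm
    exact .inr (constituentsOver_ssubset hNM hEN hEM)

lemma card_primeFactors_add_ncard_le [Group.IsSolvable G] (hρ : ρ.SimpleUnder ⊤ ⊤)
    (M : Subgroup G) [M.Normal] {S : Submodule ℂ V} (hS : ρ.SimpleUnder M S) :
    (Module.finrank ℂ S).primeFactors.card + (constituentsOver ρ.character M).ncard ≤
      eta ρ.character := by
  induction hc : Nat.card M using Nat.strong_induction_on generalizing M S with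
  | _ c ih =>
  by_cases hM : M = ⊥
  · subst hM
    rw [hS.finrank_eq_one_of_bot]
    simpa using ncard_constituentsOver_le_eta _ _
  have : Nontrivial V := by
    have := hS.nontrivial
    exact S.injective_subtype.nontrivial
  obtain ⟨p, k, N, hp, hN, hNM, hidx⟩ := Subgroup.exists_normal_lt_of_isSolvable hM
  obtain ⟨T, hT⟩ := exists_simpleUnder ρ N
  have hcard : Nat.card N < c := by
    rw [← hc]
    exact Set.Finite.card_lt_card (Set.toFinite _) hNM
  have h1 := ih _ hcard N hT rfl
  have hfin := finite_constituentsOver ρ.character N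
  rcases finrank_eq_or_constituentsOver_ssubset hρ hNM.le hS hT with h2 | h2
  · rw [h2]
    have := Set.ncard_le_ncard (constituentsOver_anti ρ.character hNM.le) hfin
    omega
  · have h3 := Set.ncard_lt_ncard h2 hfin
    obtain ⟨j, hj⟩ := finrank_of_simpleUnder_relIndex_prime_pow hρ hNM.le hp hidx hS hT
    have := hT.nontrivial
    have h4 := (Module.finrank_pos (R := ℂ) (M := T)).ne'
    have h5 : (Module.finrank ℂ S).primeFactors.card ≤
        1 + (Module.finrank ℂ T).primeFactors.card := by
      rw [hj, Nat.primeFactors_mul (pow_ne_zero _ hp.ne_zero) h4]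
      have hsub : (p ^ j).primeFactors ⊆ {p} := fun q hq => Finset.mem_singleton.2 <|
        (Nat.prime_dvd_prime_iff_eq (Nat.prime_of_mem_primeFactors hq) hp).1 <|
          (Nat.prime_of_mem_primeFactors hq).dvd_of_dvd_pow (Nat.dvd_of_mem_primeFactors hq)
      exact (Finset.card_union_le _ _).trans
        (Nat.add_le_add_right ((Finset.card_le_card hsub).trans (Finset.card_singleton p).le) _)
    omega

/-- In the supersolvable case the degree grows by single primes along a chain of normal subgroups
of prime relative index, and when it first grows, from `1` over `N`, the subgroup `N` cannot act by
scalars; this accounts for the additional constituent. -/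
lemma length_primeFactorsList_add_ncard_le (hG : IsSupersolvable G) (hρ : ρ.SimpleUnder ⊤ ⊤)
    (M : Subgroup G) [M.Normal] {S : Submodule ℂ V} (hS : ρ.SimpleUnder M S)
    (h1S : Module.finrank ℂ S ≠ 1) :
    (Module.finrank ℂ S).primeFactorsList.length + 1 + (constituentsOver ρ.character M).ncard ≤
      eta ρ.character := by
  induction hc : Nat.card M using Nat.strong_induction_on generalizing M S with
  | _ c ih =>
  by_cases hM : M = ⊥
  · subst hM
    exact absurd hS.finrank_eq_one_of_bot h1S
  have : Nontrivial V := by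
    have := hS.nontrivial
    exact S.injective_subtype.nontrivial
  obtain ⟨p, N, hp, hN, hNM, hidx⟩ := hG.exists_normal_lt hM
  obtain ⟨T, hT⟩ := exists_simpleUnder ρ N
  have hcard : Nat.card N < c := by
    rw [← hc]
    exact Set.Finite.card_lt_card (Set.toFinite _) hNM
  have hfin := finite_constituentsOver ρ.character N
  have := hT.nontrivial
  have h4 := (Module.finrank_pos (R := ℂ) (M := T)).ne'
  by_cases heq : Module.finrank ℂ S = Module.finrank ℂ T
  · have h1 := ih _ hcard N hT (heq ▸ h1S) rfl
    rw [heq]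
    have := Set.ncard_le_ncard (constituentsOver_anti ρ.character hNM.le) hfin
    omega
  have h2 := (finrank_eq_or_constituentsOver_ssubset hρ hNM.le hS hT).resolve_left heq
  have h3 := Set.ncard_lt_ncard h2 hfin
  have hmul := (finrank_of_simpleUnder_relIndex_prime hρ hNM.le hp hidx hS hT).resolve_left heq
  have hlen : (Module.finrank ℂ S).primeFactorsList.length =
      1 + (Module.finrank ℂ T).primeFactorsList.length := by
    rw [hmul, (Nat.perm_primeFactorsList_mul hp.ne_zero h4).length_eq, List.length_append,
      Nat.primeFactorsList_prime hp, List.length_singleton]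
  -- at the first growth of the degree, the extra constituent is one over `1` but not over `N`
  by_cases h1T : Module.finrank ℂ T = 1
  · have hcomm : ¬ ∀ E, ρ.CommutesWith N E := by
      intro hcomm
      obtain ⟨S', hS', h1⟩ := exists_simpleUnder_finrank_one hp hidx hcomm
      exact h1S ((finrank_eq_of_simpleUnder_normal hρ hS hS').trans h1)
    push Not at hcomm
    obtain ⟨E, hE⟩ := hcomm
    have hEbot : ρ.CommutesWith ⊥ E := fun g hg v => by
      rw [Subgroup.mem_bot.1 hg]
      simp
    have h5 := Set.ncard_lt_ncard (constituentsOver_ssubset bot_le hEbot hE)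
      (finite_constituentsOver ρ.character ⊥)
    have h6 := ncard_constituentsOver_le_eta ρ.character ⊥
    rw [hlen, h1T, Nat.primeFactorsList_one, List.length_nil]
    omega
  · have h1 := ih _ hcard N hT h1T rfl
    omega

end Representation

theorem theoremB {G : Type*} [Group G] [Fintype G] (hG : Group.IsSolvable G)
    (χ : G → ℂ) (hχ : χ ∈ Irr G) :
    ∃ d : ℕ, 0 < d ∧ χ 1 = (d : ℂ) ∧
      d.primeFactors.card ≤ eta χ ∧
      (IsSupersolvable G → 1 < d → d.primeFactorsList.length + 1 ≤ eta χ) := by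
  obtain ⟨n, ρ, hρ, rfl⟩ := hχ
  have hs := Representation.simpleUnder_top_iff.2 hρ
  have := hs.nontrivial
  refine ⟨Module.finrank ℂ (⊤ : Submodule ℂ (Fin n → ℂ)), Module.finrank_pos, ?_, ?_, ?_⟩
  · rw [Representation.char_one, finrank_top]
  · exact (Nat.le_add_right _ _).trans (Representation.card_primeFactors_add_ncard_le hs ⊤ hs)
  · exact fun hS hd =>
      (Nat.le_add_right _ _).trans (Representation.length_primeFactorsList_add_ncard_le hS hs ⊤ hs hd.ne')
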